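/- Let $E$ be a finite-dimensional complex Hilbert space, $\mathcal L(E)$ the algebra of linear operators on $E$, $\mathbb T$ the unit circle with normalised Lebesgue measure. Let $L^2(E)$, $L^2(\mathcal L(E))$ be the spaces of square integrable functions on $\mathbb T$ with values in $E$, respectively $\mathcal L(E)$, and let $H^2(E)$, $H^2(\mathcal L(E))$ be their subspaces of functions whose negative Fourier coefficients vanish. Let $\Theta$ be a pure inner function, that is, $\Theta\in H^2(\mathcal L(E))$, $\Theta(e^{it})$ is unitary for almost every $t$, and $\|\Theta(0)\|<1$, where $\Theta(0)$ is the value at $0$ of the analytic extension of $\Theta$ to the unit disc. Let $\mathcal K_\Theta=H^2(E)\ominus\Theta H^2(E)$, let $P_\Theta$ be the orthogonal projection of $L^2(E)$ onto $\mathcal K_\Theta$, and let $\mathcal K_\Theta^\infty$ be the (dense) subspace of all bounded functions in $\mathcal K_\Theta$. A bounded operator $A$ on $\mathcal K_\Theta$ is called a matrix-valued truncated Toeplitz operator if there is $\Phi\in L^2(\mathcal L(E))$ such that $Af=P_\Theta(\Phi f)$ for all $f\in\mathcal K_\Theta^\infty$; let $\mathcal{MT}(\mathcal K_\Theta)$ be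 the linear space of all such operators. Then $\mathcal{MT}(\mathcal K_\Theta)$ is closed in the weak operator topology of the space of bounded operators on $\mathcal K_\Theta$. -/

import Mathlib

open MeasureTheory AddCircle
open scoped ENNReal InnerProductSpace

noncomputable section

namespace MatrixTTO

instance instFactTwoPiPos : Fact (0 < 2 * Real.pi) := ⟨Real.two_pi_pos⟩

/-- The unit circle, parametrised by the angle `t` modulo `2π`; the point `t` stands for `e^{it}`,
and `fourier n` is the function `e^{int}`. -/
abbrev UCircle : Type := AddCircle (2 * Real.pi)

/-- Normalised Lebesgue measure `dt / 2π` on the circle. -/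
abbrev arc : Measure UCircle := haarAddCircle

/-- The space `L²(F)` of (classes of) square integrable `F`-valued functions on the circle. For
`F = E` a Hilbert space it carries the inner product `(1/2π) ∫ ⟪F(e^{it}), G(e^{it})⟫ dt`. For
`F = 𝓛(E)`, `dim E < ∞`, the choice of the norm on `𝓛(E)` does not change the space. -/
abbrev L2 (F : Type*) [NormedAddCommGroup F] : Type _ := Lp F 2 arc

theorem L2.integrable {F : Type*} [NormedAddCommGroup F] (f : L2 F) : Integrable f arc :=
  (Lp.memLp f).integrable (by norm_num)

section Hardy

variable {F : Type*} [NormedAddCommGroup F] [NormedSpace ℂ F]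

/-- The `n`-th Fourier coefficient as a continuous linear map on `L²(F)`. -/
def coeffL (F : Type*) [NormedAddCommGroup F] [NormedSpace ℂ F] (n : ℤ) : L2 F →L[ℂ] F :=
  LinearMap.mkContinuous
    { toFun := fun f => fourierCoeff f n
      map_add' := fun f g => by
        rw [fourierCoeff_congr_ae (Lp.coeFn_add f g),
          fourierCoeff.add (L2.integrable f) (L2.integrable g)]
        rfl
      map_smul' := fun c f => by
        rw [fourierCoeff_congr_ae (Lp.coeFn_smul c f), fourierCoeff.const_smul]
        rfl } 1 (by
      intro f
      rw [one_mul]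
      have h1 : ‖fourierCoeff f n‖ ≤ ∫ t, ‖f t‖ ∂arc := by
        refine (norm_integral_le_integral_norm _).trans (le_of_eq ?_)
        refine integral_congr_ae (Filter.Eventually.of_forall fun t => ?_)
        simp only [norm_smul, fourier_apply, Circle.norm_coe, one_mul]
      have h2 : ∫ t, ‖f t‖ ∂arc ≤ ‖f‖ := by
        rw [integral_norm_eq_lintegral_enorm (Lp.aestronglyMeasurable f), Lp.norm_def,
          ← eLpNorm_one_eq_lintegral_enorm]
        exact ENNReal.toReal_mono (Lp.eLpNorm_ne_top f)
          (eLpNorm_le_eLpNorm_of_exponent_le (by norm_num) (Lp.aestronglyMeasurable f))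
      exact h1.trans h2)

@[simp]
theorem coeffL_apply (n : ℤ) (f : L2 F) : coeffL F n f = fourierCoeff f n := rfl

/-- The Hardy space `H²(F)`: the functions in `L²(F)` with vanishing negative Fourier
coefficients. -/
def hardy (F : Type*) [NormedAddCommGroup F] [NormedSpace ℂ F] : Submodule ℂ (L2 F) where
  carrier := {f | ∀ n : ℤ, n < 0 → fourierCoeff f n = 0}
  add_mem' := fun {f g} hf hg n hn => by
    rw [← coeffL_apply, map_add, coeffL_apply, coeffL_apply, hf n hn, hg n hn, add_zero]
  zero_mem' := fun n _ => by rw [← coeffL_apply, map_zero]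
  smul_mem' := fun c f hf n hn => by
    rw [← coeffL_apply, map_smul, coeffL_apply, hf n hn, smul_zero]

theorem isClosed_hardy : IsClosed (hardy F : Set (L2 F)) := by
  have h : (hardy F : Set (L2 F)) = ⋂ n : ℤ, ⋂ _ : n < 0, {f | coeffL F n f = 0} := by
    ext f
    simp [hardy]
  rw [h]
  exact isClosed_iInter fun n => isClosed_iInter fun _ =>
    isClosed_eq (coeffL F n).continuous continuous_const

/-- The value at the point `z` of the open unit disc of the analytic extension
`f(z) = ∑ₙ aₙ zⁿ` of a function `f` in `H²(F)` with Fourier coefficients `aₙ`. -/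
def diskValue (f : L2 F) (z : ℂ) : F := ∑' n : ℕ, z ^ n • fourierCoeff f (n : ℤ)

end Hardy

variable {E : Type*} [NormedAddCommGroup E] [InnerProductSpace ℂ E]

/-- An inner function: an element of `H²(𝓛(E))` whose boundary values are almost everywhere
unitary operators on `E`. -/
structure IsInner [CompleteSpace E] (Θ : L2 (E →L[ℂ] E)) : Prop where
  mem_hardy : Θ ∈ hardy (E →L[ℂ] E)
  unitary_ae : ∀ᵐ t ∂arc, Θ t ∈ unitary (E →L[ℂ] E)

/-- A pure inner function: `‖Θ(0)‖ < 1`. -/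
structure IsPureInner [CompleteSpace E] (Θ : L2 (E →L[ℂ] E)) : Prop extends IsInner Θ where
  norm_value_zero_lt_one : ‖diskValue Θ 0‖ < 1

/-- The space `Θ H²(E)` of all products `Θ h`, `h ∈ H²(E)` (as elements of `L²(E)`). -/
def thetaHardy (Θ : L2 (E →L[ℂ] E)) : Submodule ℂ (L2 E) where
  carrier := {g | ∃ h ∈ hardy E, g =ᵐ[arc] fun t => Θ t (h t)}
  add_mem' := by
    rintro g₁ g₂ ⟨h₁, m₁, e₁⟩ ⟨h₂, m₂, e₂⟩
    refine ⟨h₁ + h₂, (hardy E).add_mem m₁ m₂, ?_⟩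
    filter_upwards [e₁, e₂, Lp.coeFn_add g₁ g₂, Lp.coeFn_add h₁ h₂] with t a b c d
    rw [c, d, Pi.add_apply, Pi.add_apply, a, b, map_add]
  zero_mem' := by
    refine ⟨0, (hardy E).zero_mem, ?_⟩
    filter_upwards [Lp.coeFn_zero E 2 arc] with t a
    rw [a, Pi.zero_apply, map_zero]
  smul_mem' := by
    rintro c g ⟨h, m, e⟩
    refine ⟨c • h, (hardy E).smul_mem c m, ?_⟩
    filter_upwards [e, Lp.coeFn_smul c g, Lp.coeFn_smul c h] with t a b d
    rw [b, d, Pi.smul_apply, Pi.smul_apply, a, map_smul]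

/-- The model space `K_Θ = H²(E) ⊖ Θ H²(E)`, with the inner product of `L²(E)`. -/
def modelSpace (Θ : L2 (E →L[ℂ] E)) : Submodule ℂ (L2 E) := hardy E ⊓ (thetaHardy Θ)ᗮ

instance instCompleteSpaceModelSpace [CompleteSpace E] (Θ : L2 (E →L[ℂ] E)) :
    CompleteSpace (modelSpace Θ) := by
  have h : IsClosed (modelSpace Θ : Set (L2 E)) :=
    isClosed_hardy.inter (Submodule.isClosed_orthogonal _)
  exact h.completeSpace_coe

/-- The orthogonal projection `P_Θ` of `L²(E)` onto the model space. -/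
def modelProj [CompleteSpace E] (Θ : L2 (E →L[ℂ] E)) : L2 E →L[ℂ] modelSpace Θ :=
  (modelSpace Θ).orthogonalProjectionOnto

theorem memLp_mul (Φ : L2 (E →L[ℂ] E)) {f : UCircle → E} (hf : MemLp f ∞ arc) :
    MemLp (fun t => Φ t (f t)) 2 arc :=
  (ContinuousLinearMap.id ℂ (E →L[ℂ] E)).memLp_of_bilin 2 (Lp.memLp Φ) hf

/-- The product `Φ f ∈ L²(E)` of `Φ ∈ L²(𝓛(E))` and a bounded function `f`. -/
def mulL2 (Φ : L2 (E →L[ℂ] E)) (f : L2 E) (hf : MemLp f ∞ arc) : L2 E :=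
  (memLp_mul Φ hf).toLp _

theorem coeFn_mulL2 (Φ : L2 (E →L[ℂ] E)) (f : L2 E) (hf : MemLp f ∞ arc) :
    mulL2 Φ f hf =ᵐ[arc] fun t => Φ t (f t) :=
  (memLp_mul Φ hf).coeFn_toLp

theorem mulL2_add (Φ Ψ : L2 (E →L[ℂ] E)) (f : L2 E) (hf : MemLp f ∞ arc) :
    mulL2 (Φ + Ψ) f hf = mulL2 Φ f hf + mulL2 Ψ f hf := by
  refine Lp.ext ?_
  filter_upwards [coeFn_mulL2 (Φ + Ψ) f hf, coeFn_mulL2 Φ f hf, coeFn_mulL2 Ψ f hf,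
    Lp.coeFn_add (mulL2 Φ f hf) (mulL2 Ψ f hf), Lp.coeFn_add Φ Ψ] with t a b c d e
  rw [a, d, Pi.add_apply, b, c, e, Pi.add_apply, _root_.add_apply]

theorem mulL2_zero (f : L2 E) (hf : MemLp f ∞ arc) : mulL2 0 f hf = 0 := by
  refine Lp.ext ?_
  filter_upwards [coeFn_mulL2 0 f hf, Lp.coeFn_zero E 2 arc,
    Lp.coeFn_zero (E →L[ℂ] E) 2 arc] with t a b c
  rw [a, b, c, Pi.zero_apply, Pi.zero_apply, _root_.zero_apply]

theorem mulL2_smul (c : ℂ) (Φ : L2 (E →L[ℂ] E)) (f : L2 E) (hf : MemLp f ∞ arc) :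
    mulL2 (c • Φ) f hf = c • mulL2 Φ f hf := by
  refine Lp.ext ?_
  filter_upwards [coeFn_mulL2 (c • Φ) f hf, coeFn_mulL2 Φ f hf,
    Lp.coeFn_smul c (mulL2 Φ f hf), Lp.coeFn_smul c Φ] with t a b d e
  rw [a, d, Pi.smul_apply, b, e, Pi.smul_apply, _root_.smul_apply]

/-- `A = A_Φ^Θ`: the bounded operator `A` on the model space extends the map `f ↦ P_Θ (Φ f)`,
which is defined on the bounded functions `f` in the model space. -/
def HasSymbol [CompleteSpace E] (Θ : L2 (E →L[ℂ] E))
    (A : modelSpace Θ →L[ℂ] modelSpace Θ) (Φ : L2 (E →L[ℂ] E)) : Prop :=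
  ∀ (f : modelSpace Θ) (hf : MemLp (f : L2 E) ∞ arc), A f = modelProj Θ (mulL2 Φ f hf)

/-- The space of all matrix-valued truncated Toeplitz operators on the model space, that is, of
all bounded operators `A_Φ^Θ` with a symbol `Φ ∈ L²(𝓛(E))`. -/
def MTT [CompleteSpace E] (Θ : L2 (E →L[ℂ] E)) :
    Submodule ℂ (modelSpace Θ →L[ℂ] modelSpace Θ) where
  carrier := {A | ∃ Φ : L2 (E →L[ℂ] E), HasSymbol Θ A Φ}
  add_mem' := by
    rintro A B ⟨Φ, hA⟩ ⟨Ψ, hB⟩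
    refine ⟨Φ + Ψ, fun f hf => ?_⟩
    rw [mulL2_add, map_add, ← hA f hf, ← hB f hf, _root_.add_apply]
  zero_mem' := by
    refine ⟨0, fun f hf => ?_⟩
    rw [mulL2_zero, map_zero, _root_.zero_apply]
  smul_mem' := by
    rintro c A ⟨Φ, hA⟩
    refine ⟨c • Φ, fun f hf => ?_⟩
    rw [mulL2_smul, map_smul, ← hA f hf, _root_.smul_apply]

end MatrixTTO

end

/-! A bounded operator `A` on the model space is a truncated Toeplitz operator iff it is shift
invariant (`IsPureInner.mem_MTT_iff`): `⟪zg, A(zf)⟫ = ⟪g, Af⟫` for bounded `f`, `g` such that all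
four functions lie in the model space. Each such equation is a closed condition on `A` in the weak
operator topology, hence so is their conjunction.

Necessity holds because multiplication by `Φ` commutes with `z`, which acts unitarily on `L²(E)`.
For sufficiency, let `L` be the backward shift on the model space. The form of `T = A - L*AL`
vanishes on bounded functions that are zero at `0`. Purity gives evaluation at `0` a right inverse
with bounded values (`exists_section`), so `T = B ev₀ + (C ev₀)*` (`exists_decomposition`).
Telescoping, with `Lⁿ → 0` strongly, gives `⟪g, Af⟫ = ∑ ⟪Lʲg, T Lʲf⟫`. As `ev₀ Lʲ f` is the `j`-th
Fourier coefficient of `f`, this series is the form of multiplication by `Φ + Ψ*`, where `Φ`, `Ψ`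
have the columns `Bx`, `Cx`. -/

noncomputable section

namespace MatrixTTO

/-! ### Fourier series and shifts on `L²(E)`. -/

section Fourier

variable {E : Type*} [NormedAddCommGroup E] [InnerProductSpace ℂ E]

/-- The multiplication operator on `L²(E)` by an essentially bounded operator-valued function. -/
def mulOp (Ψ : Lp (E →L[ℂ] E) ∞ arc) : L2 E →L[ℂ] L2 E :=
  (ContinuousLinearMap.id ℂ (E →L[ℂ] E)).holderL arc ∞ 2 2 Ψ

theorem coeFn_mulOp (Ψ : Lp (E →L[ℂ] E) ∞ arc) (f : L2 E) :
    mulOp Ψ f =ᵐ[arc] fun t => Ψ t (f t) :=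
  (ContinuousLinearMap.id ℂ (E →L[ℂ] E)).coeFn_holder Ψ f

/-- Multiplication by `e^{int}` on `L²(E)`. -/
def shift (E : Type*) [NormedAddCommGroup E] [InnerProductSpace ℂ E] (n : ℤ) :
    L2 E →L[ℂ] L2 E :=
  (ContinuousLinearMap.lsmul ℂ ℂ).holderL arc ∞ 2 2 (fourierLp ∞ n)

theorem coeFn_shift (n : ℤ) (f : L2 E) : shift E n f =ᵐ[arc] fun t => fourier n t • f t := by
  filter_upwards [(ContinuousLinearMap.lsmul ℂ ℂ).coeFn_holder (r := 2) (fourierLp ∞ n) f,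
    coeFn_fourierLp (T := 2 * Real.pi) ∞ n] with t h1 h2
  rw [← h2]
  exact h1

/-- The function `e^{int} x`, as an element of `L²(E)`. -/
def mono (E : Type*) [NormedAddCommGroup E] [InnerProductSpace ℂ E] (n : ℤ) : E →ₗ[ℂ] L2 E where
  toFun x := ((ContinuousLinearMap.id ℂ ℂ).smulRight x).compLpL 2 arc (fourierLp 2 n)
  map_add' x y := by
    rw [show (ContinuousLinearMap.id ℂ ℂ).smulRight (x + y)
      = (ContinuousLinearMap.id ℂ ℂ).smulRight x + (ContinuousLinearMap.id ℂ ℂ).smulRight y by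
        ext; simp, ContinuousLinearMap.add_compLpL]
    rfl
  map_smul' c x := by
    rw [show (ContinuousLinearMap.id ℂ ℂ).smulRight (c • x)
      = c • (ContinuousLinearMap.id ℂ ℂ).smulRight x by ext; simp,
      ContinuousLinearMap.smul_compLpL]
    rfl

theorem coeFn_mono (n : ℤ) (x : E) : mono E n x =ᵐ[arc] fun t => fourier n t • x := by
  filter_upwards [((ContinuousLinearMap.id ℂ ℂ).smulRight x).coeFn_compLpL (p := 2) (μ := arc)
    (fourierLp 2 n), coeFn_fourierLp (T := 2 * Real.pi) 2 n] with t h1 h2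
  rw [← h2]
  exact h1

theorem fourierCoeff_shift (n m : ℤ) (f : L2 E) :
    fourierCoeff (shift E n f) m = fourierCoeff f (m - n) := by
  rw [fourierCoeff_congr_ae (coeFn_shift n f)]
  refine integral_congr_ae (Filter.Eventually.of_forall fun t => ?_)
  simp only [smul_smul, ← fourier_add]
  congr 3
  ring

theorem shift_shift (n m : ℤ) (f : L2 E) : shift E n (shift E m f) = shift E (n + m) f := by
  refine Lp.ext ?_
  filter_upwards [coeFn_shift n (shift E m f), coeFn_shift m f, coeFn_shift (n + m) f]
    with t h1 h2 h3
  rw [h1, h2, h3, smul_smul, fourier_add]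

theorem shift_zero (f : L2 E) : shift E 0 f = f := by
  refine Lp.ext ?_
  filter_upwards [coeFn_shift 0 f] with t h1
  rw [h1, fourier_zero, one_smul]

theorem shift_mono (n m : ℤ) (x : E) : shift E n (mono E m x) = mono E (n + m) x := by
  refine Lp.ext ?_
  filter_upwards [coeFn_shift n (mono E m x), coeFn_mono m x, coeFn_mono (n + m) x]
    with t h1 h2 h3
  rw [h1, h2, h3, smul_smul, fourier_add]

theorem inner_shift_shift (n : ℤ) (f g : L2 E) :
    ⟪shift E n f, shift E n g⟫_ℂ = ⟪f, g⟫_ℂ := by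
  rw [L2.inner_def, L2.inner_def]
  refine integral_congr_ae ?_
  filter_upwards [coeFn_shift n f, coeFn_shift n g] with t h1 h2
  rw [h1, h2, inner_smul_left, inner_smul_right, ← mul_assoc, ← fourier_neg, ← fourier_add,
    neg_add_cancel, fourier_zero, one_mul]

theorem inner_shift_left (n : ℤ) (f g : L2 E) :
    ⟪shift E n f, g⟫_ℂ = ⟪f, shift E (-n) g⟫_ℂ := by
  rw [← inner_shift_shift n f, shift_shift, add_neg_cancel, shift_zero]

theorem norm_shift (n : ℤ) (f : L2 E) : ‖shift E n f‖ = ‖f‖ := by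
  rw [@norm_eq_sqrt_re_inner ℂ, @norm_eq_sqrt_re_inner ℂ, inner_shift_shift]

theorem fourierCoeff_mono [CompleteSpace E] (n m : ℤ) (x : E) :
    fourierCoeff (mono E n x) m = if n = m then x else 0 := by
  have h := fourierCoeff_fourier (T := 2 * Real.pi) n
  rw [fourierCoeff_congr_ae (coeFn_mono n x)]
  have h1 : fourierCoeff (fun t : UCircle => fourier n t • x) m
      = fourierCoeff (fourier n : UCircle → ℂ) m • x := by
    simp only [fourierCoeff, smul_eq_mul, ← smul_smul, ← integral_smul_const]
  rw [h1, h]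
  by_cases hnm : n = m
  · subst hnm; simp
  · simp [hnm, Ne.symm hnm]

theorem inner_mono_left [CompleteSpace E] (n : ℤ) (x : E) (f : L2 E) :
    ⟪mono E n x, f⟫_ℂ = ⟪x, fourierCoeff f n⟫_ℂ := by
  have hi : Integrable (fun t => fourier (-n) t • f t) arc :=
    (L2.integrable f).fourier_smul (-n)
  rw [L2.inner_def, fourierCoeff, ← integral_inner hi]
  refine integral_congr_ae ?_
  filter_upwards [coeFn_mono n x] with t h1
  rw [h1, inner_smul_left, inner_smul_right, fourier_neg]

theorem inner_mono_right [CompleteSpace E] (n : ℤ) (x : E) (f : L2 E) :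
    ⟪f, mono E n x⟫_ℂ = ⟪fourierCoeff f n, x⟫_ℂ := by
  rw [← inner_conj_symm, inner_mono_left, inner_conj_symm]

theorem sum_compLpL {ι : Type*} (s : Finset ι) (u : ι → E →L[ℂ] E) (f : L2 E) :
    (∑ i ∈ s, u i).compLpL 2 arc f = ∑ i ∈ s, (u i).compLpL 2 arc f := by
  classical
  induction s using Finset.induction_on with
  | empty =>
    refine Lp.ext ?_
    filter_upwards [(0 : E →L[ℂ] E).coeFn_compLpL (p := 2) (μ := arc) f,
      Lp.coeFn_zero E 2 arc] with t a b
    rw [Finset.sum_empty, Finset.sum_empty, a, b]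
    rfl
  | insert i s hi ih =>
    rw [Finset.sum_insert hi, Finset.sum_insert hi, ← ih, ContinuousLinearMap.add_compLpL]
    rfl

/-- Scalar Fourier series in each coordinate of an orthonormal basis, summed over the finitely many
coordinates. -/
theorem hasSum_mono [FiniteDimensional ℂ E] (f : L2 E) :
    HasSum (fun n : ℤ => mono E n (fourierCoeff f n)) f := by
  have : CompleteSpace E := FiniteDimensional.complete ℂ E
  let e := stdOrthonormalBasis ℂ E
  let c : Fin (Module.finrank ℂ E) → L2 ℂ := fun i => (innerSL ℂ (e i)).compLpL 2 arc f
  let J : Fin (Module.finrank ℂ E) → L2 ℂ →L[ℂ] L2 E :=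
    fun i => ((ContinuousLinearMap.id ℂ ℂ).smulRight (e i)).compLpL 2 arc
  have hc : ∀ i n, fourierCoeff (c i) n = ⟪e i, fourierCoeff f n⟫_ℂ := by
    intro i n
    have hi : Integrable (fun t => fourier (-n) t • f t) arc :=
      (L2.integrable f).fourier_smul (-n)
    rw [fourierCoeff_congr_ae ((innerSL ℂ (e i)).coeFn_compLpL f), fourierCoeff, fourierCoeff,
      ← integral_inner hi]
    refine integral_congr_ae (Filter.Eventually.of_forall fun t => ?_)
    simp [inner_smul_right]
  have hsum : HasSum (fun n : ℤ => ∑ i, J i (fourierCoeff (c i) n • fourierLp 2 n))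
      (∑ i, J i (c i)) :=
    hasSum_sum fun i _ => (J i).hasSum (hasSum_fourier_series_L2 (c i))
  have hf : ∑ i, J i (c i) = f := by
    have h1 : ∀ i, J i (c i)
        = (((ContinuousLinearMap.id ℂ ℂ).smulRight (e i)).comp (innerSL ℂ (e i))).compLpL
          2 arc f := by
      intro i
      refine Lp.ext ?_
      filter_upwards [((ContinuousLinearMap.id ℂ ℂ).smulRight (e i)).coeFn_compLpL (p := 2)
        (μ := arc) (c i), (innerSL ℂ (e i)).coeFn_compLpL (p := 2) (μ := arc) f,
        (((ContinuousLinearMap.id ℂ ℂ).smulRight (e i)).comp (innerSL ℂ (e i))).coeFn_compLpL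
          (p := 2) (μ := arc) f] with t a b d
      rw [a, b, d]
      rfl
    have h3 : ∑ i, ((ContinuousLinearMap.id ℂ ℂ).smulRight (e i)).comp (innerSL ℂ (e i))
        = ContinuousLinearMap.id ℂ E := by
      ext x
      simp only [_root_.sum_apply, ContinuousLinearMap.comp_apply,
        ContinuousLinearMap.smulRight_apply, ContinuousLinearMap.id_apply, innerSL_apply_apply]
      exact e.sum_repr' x
    rw [Finset.sum_congr rfl fun i _ => h1 i, ← sum_compLpL, h3]
    refine Lp.ext ?_
    filter_upwards [(ContinuousLinearMap.id ℂ E).coeFn_compLpL (p := 2) (μ := arc) f] with t a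
    rw [a]
    rfl
  rw [hf] at hsum
  convert! hsum using 2 with n
  conv_lhs => rw [← e.sum_repr' (fourierCoeff f n), map_sum]
  refine Finset.sum_congr rfl fun i _ => ?_
  rw [map_smul, map_smul, hc]
  rfl

end Fourier

/-! ### Bounded functions and Hardy space membership. -/

section Bounded

variable {E : Type*} [NormedAddCommGroup E] [InnerProductSpace ℂ E]

/-- The bounded functions in `L²(E)`. -/
def bounded (E : Type*) [NormedAddCommGroup E] [InnerProductSpace ℂ E] : Submodule ℂ (L2 E) where
  carrier := {f | MemLp f ∞ arc}
  add_mem' := fun {f g} hf hg => (hf.add hg).ae_eq (Lp.coeFn_add f g).symm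
  zero_mem' := (MemLp.zero (ε := E)).ae_eq (Lp.coeFn_zero E 2 arc).symm
  smul_mem' := fun c f hf => (hf.const_smul c).ae_eq (Lp.coeFn_smul c f).symm

theorem mulOp_mem_bounded (Ψ : Lp (E →L[ℂ] E) ∞ arc) {f : L2 E} (hf : f ∈ bounded E) :
    mulOp Ψ f ∈ bounded E :=
  ((ContinuousLinearMap.id ℂ (E →L[ℂ] E)).memLp_of_bilin ∞ (Lp.memLp Ψ) hf).ae_eq
    (coeFn_mulOp Ψ f).symm

theorem shift_mem_bounded (n : ℤ) {f : L2 E} (hf : f ∈ bounded E) : shift E n f ∈ bounded E :=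
  ((ContinuousLinearMap.lsmul ℂ ℂ).memLp_of_bilin ∞ (Lp.memLp (fourierLp ∞ n)) hf).ae_eq
    ((ContinuousLinearMap.lsmul ℂ ℂ).coeFn_holder (r := 2) (fourierLp ∞ n) f).symm

theorem mono_mem_bounded (n : ℤ) (x : E) : mono E n x ∈ bounded E := by
  refine MemLp.ae_eq (coeFn_mono n x).symm (memLp_top_of_bound ?_ ‖x‖ ?_)
  · exact ((fourier n).continuous.smul continuous_const).aestronglyMeasurable
  · refine Filter.Eventually.of_forall fun t => ?_
    rw [norm_smul, fourier_apply, Circle.norm_coe, one_mul]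

theorem shift_mem_hardy {n : ℤ} (hn : 0 ≤ n) {f : L2 E} (hf : f ∈ hardy E) :
    shift E n f ∈ hardy E := by
  intro m hm
  rw [fourierCoeff_shift]
  exact hf _ (by omega)

theorem mono_mem_hardy [CompleteSpace E] {n : ℤ} (hn : 0 ≤ n) (x : E) : mono E n x ∈ hardy E := by
  intro m hm
  rw [fourierCoeff_mono, if_neg (by omega)]

end Bounded

/-! ### The model space, its kernels, and evaluation at `0`. -/

section Model

variable {E : Type*} [NormedAddCommGroup E] [InnerProductSpace ℂ E] [CompleteSpace E]
  {Θ : L2 (E →L[ℂ] E)}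

theorem IsInner.memLp_top (hΘ : IsInner Θ) : MemLp Θ ∞ arc := by
  refine memLp_top_of_bound (Lp.aestronglyMeasurable Θ) 1 ?_
  filter_upwards [hΘ.unitary_ae] with t ht
  refine ContinuousLinearMap.opNorm_le_bound _ zero_le_one fun x => ?_
  rw [ContinuousLinearMap.norm_map_of_mem_unitary ht, one_mul]

/-- Multiplication by an inner function on `L²(E)`. -/
def IsInner.mul (hΘ : IsInner Θ) : L2 E →L[ℂ] L2 E :=
  mulOp (hΘ.memLp_top.toLp Θ)

theorem IsInner.coeFn_mul (hΘ : IsInner Θ) (f : L2 E) :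
    hΘ.mul f =ᵐ[arc] fun t => Θ t (f t) := by
  filter_upwards [coeFn_mulOp (hΘ.memLp_top.toLp Θ) f, hΘ.memLp_top.coeFn_toLp] with t h1 h2
  rw [← h2]
  exact h1

theorem IsInner.inner_mul_mul (hΘ : IsInner Θ) (f g : L2 E) :
    ⟪hΘ.mul f, hΘ.mul g⟫_ℂ = ⟪f, g⟫_ℂ := by
  rw [L2.inner_def, L2.inner_def]
  refine integral_congr_ae ?_
  filter_upwards [hΘ.coeFn_mul f, hΘ.coeFn_mul g, hΘ.unitary_ae] with t h1 h2 h3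
  rw [h1, h2, ContinuousLinearMap.inner_map_map_of_mem_unitary h3]

theorem IsInner.mul_shift (hΘ : IsInner Θ) (n : ℤ) (f : L2 E) :
    hΘ.mul (shift E n f) = shift E n (hΘ.mul f) := by
  refine Lp.ext ?_
  filter_upwards [hΘ.coeFn_mul (shift E n f), coeFn_shift n f, coeFn_shift n (hΘ.mul f),
    hΘ.coeFn_mul f] with t h1 h2 h3 h4
  rw [h1, h2, h3, h4, map_smul]

theorem IsInner.mem_thetaHardy_iff (hΘ : IsInner Θ) {g : L2 E} :
    g ∈ thetaHardy Θ ↔ ∃ h ∈ hardy E, g = hΘ.mul h := by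
  refine exists_congr fun h => and_congr_right fun _ => ⟨fun e => Lp.ext ?_, fun e => ?_⟩
  · exact e.trans (hΘ.coeFn_mul h).symm
  · rw [e]
    exact hΘ.coeFn_mul h

theorem IsInner.mem_modelSpace_iff (hΘ : IsInner Θ) {f : L2 E} :
    f ∈ modelSpace Θ ↔ f ∈ hardy E ∧ ∀ h ∈ hardy E, ⟪hΘ.mul h, f⟫_ℂ = 0 := by
  refine and_congr_right fun _ => ?_
  rw [SetLike.mem_coe, Submodule.mem_orthogonal]
  constructor
  · exact fun H h hh => H _ (hΘ.mem_thetaHardy_iff.2 ⟨h, hh, rfl⟩)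
  · intro H u hu
    obtain ⟨h, hh, rfl⟩ := hΘ.mem_thetaHardy_iff.1 hu
    exact H h hh

theorem IsInner.fourierCoeff_mul_mono (hΘ : IsInner Θ) (n j : ℤ) (x : E) :
    fourierCoeff (hΘ.mul (mono E j x)) n = fourierCoeff Θ (n - j) x := by
  have hi : Integrable (fun t => fourier (-(n - j)) t • Θ t) arc :=
    (L2.integrable Θ).fourier_smul _
  rw [fourierCoeff, fourierCoeff, ContinuousLinearMap.integral_apply hi]
  refine integral_congr_ae ?_
  filter_upwards [hΘ.coeFn_mul (mono E j x), coeFn_mono j x] with t h1 h2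
  rw [h1, h2, map_smul, smul_smul, ← fourier_add, _root_.smul_apply]
  congr 2
  ring_nf

/-- The projection of `e^{int} x` to the model space: an analytic polynomial minus `Θ` times an
analytic polynomial. -/
def IsInner.kernel (hΘ : IsInner Θ) (n : ℤ) : E →ₗ[ℂ] L2 E :=
  mono E n - hΘ.mul.toLinearMap ∘ₗ
    ∑ j ∈ Finset.Icc 0 n, mono E j ∘ₗ (fourierCoeff Θ (n - j)).adjoint.toLinearMap

theorem IsInner.kernel_apply (hΘ : IsInner Θ) (n : ℤ) (x : E) :
    hΘ.kernel n x = mono E n x - hΘ.mul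
      (∑ j ∈ Finset.Icc 0 n, mono E j ((fourierCoeff Θ (n - j)).adjoint x)) := by
  simp [kernel]

theorem IsInner.kernel_mem_bounded (hΘ : IsInner Θ) (n : ℤ) (x : E) :
    hΘ.kernel n x ∈ bounded E := by
  rw [hΘ.kernel_apply]
  exact sub_mem (mono_mem_bounded n x)
    (mulOp_mem_bounded _ (sum_mem fun j _ => mono_mem_bounded j _))

theorem sum_mono_mem_hardy (n : ℤ) (x : ℤ → E) :
    ∑ j ∈ Finset.Icc 0 n, mono E j (x j) ∈ hardy E :=
  sum_mem fun _ hj => mono_mem_hardy (Finset.mem_Icc.1 hj).1 _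

/-- Reproducing property: the term subtracted from `e^{int} x` lies in `Θ H²(E)`, which is
orthogonal to `f`. -/
theorem IsInner.inner_kernel (hΘ : IsInner Θ) (n : ℤ) (x : E) {f : L2 E}
    (hf : f ∈ modelSpace Θ) : ⟪hΘ.kernel n x, f⟫_ℂ = ⟪x, fourierCoeff f n⟫_ℂ := by
  rw [hΘ.kernel_apply, inner_sub_left, inner_mono_left,
    (hΘ.mem_modelSpace_iff.1 hf).2 _ (sum_mono_mem_hardy n _), sub_zero]

variable [FiniteDimensional ℂ E]

/-- The Cauchy product formula for the Fourier coefficients of `Θ h`. -/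
theorem IsInner.fourierCoeff_mul (hΘ : IsInner Θ) {h : L2 E} (hh : h ∈ hardy E) (n : ℤ) :
    fourierCoeff (hΘ.mul h) n
      = ∑ j ∈ Finset.Icc 0 n, fourierCoeff Θ (n - j) (fourierCoeff h j) := by
  have h1 := ((coeffL E n).comp hΘ.mul).hasSum (hasSum_mono h)
  refine h1.unique ?_
  have h2 : ∀ j : ℤ, ((coeffL E n).comp hΘ.mul) (mono E j (fourierCoeff h j))
      = fourierCoeff Θ (n - j) (fourierCoeff h j) := fun j => by
    rw [ContinuousLinearMap.comp_apply, coeffL_apply, hΘ.fourierCoeff_mul_mono]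
  simp only [h2]
  -- Terms with `j < 0` vanish because `h` is analytic, those with `j > n` because `Θ` is.
  refine hasSum_sum_of_ne_finset_zero fun j hj => ?_
  rw [Finset.mem_Icc, not_and_or, not_le, not_le] at hj
  rcases hj with hj | hj
  · rw [hh j hj, map_zero]
  · rw [hΘ.mem_hardy (n - j) (by omega), _root_.zero_apply]

theorem IsInner.mul_mem_hardy (hΘ : IsInner Θ) {h : L2 E} (hh : h ∈ hardy E) :
    hΘ.mul h ∈ hardy E := fun n hn => by
  rw [hΘ.fourierCoeff_mul hh, Finset.Icc_eq_empty (by omega), Finset.sum_empty]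

theorem IsInner.kernel_mem_modelSpace (hΘ : IsInner Θ) {n : ℤ} (hn : 0 ≤ n) (x : E) :
    hΘ.kernel n x ∈ modelSpace Θ := by
  rw [hΘ.kernel_apply, hΘ.mem_modelSpace_iff]
  refine ⟨sub_mem (mono_mem_hardy hn x) (hΘ.mul_mem_hardy (sum_mono_mem_hardy n _)),
    fun h hh => ?_⟩
  -- `Θ` cancels in `⟪Θh, Θp⟫`; the coefficients of `p` are the adjoints that match the Cauchy
  -- product for `⟪Θh, e^{int} x⟫`.
  rw [inner_sub_right, hΘ.inner_mul_mul, inner_mono_right, hΘ.fourierCoeff_mul hh, sum_inner,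
    inner_sum, sub_eq_zero]
  refine Finset.sum_congr rfl fun j _ => ?_
  rw [inner_mono_right, ContinuousLinearMap.adjoint_inner_right]

/-- The bounded functions are dense in the model space. -/
theorem IsInner.eq_zero_of_inner_bounded (hΘ : IsInner Θ) {f : L2 E} (hf : f ∈ modelSpace Θ)
    (h : ∀ g ∈ modelSpace Θ, g ∈ bounded E → ⟪g, f⟫_ℂ = 0) : f = 0 := by
  refine (hasSum_mono f).unique ?_
  convert! hasSum_zero with n
  rcases lt_or_ge n 0 with hn | hn
  · rw [hf.1 n hn, map_zero]
  · have h1 : fourierCoeff f n = 0 := ext_inner_left ℂ fun x => by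
      rw [← hΘ.inner_kernel n x hf, inner_zero_right]
      exact h _ (hΘ.kernel_mem_modelSpace hn x) (hΘ.kernel_mem_bounded n x)
    rw [h1, map_zero]

theorem diskValue_zero {F : Type*} [NormedAddCommGroup F] [NormedSpace ℂ F]
    (f : L2 F) : diskValue f 0 = fourierCoeff f 0 := by
  rw [diskValue, tsum_eq_single 0 fun n hn => by rw [zero_pow hn, zero_smul]]
  simp

/-- The kernel at `0` is `(1 - Θ Θ(0)*) x`; the operator on the right is the one that purity makes
invertible. -/
theorem IsInner.fourierCoeff_kernel_zero (hΘ : IsInner Θ) (x : E) :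
    fourierCoeff (hΘ.kernel 0 x) 0
      = (1 - fourierCoeff Θ 0 * star (fourierCoeff Θ 0)) x := by
  rw [hΘ.kernel_apply, ← coeffL_apply, map_sub, coeffL_apply, coeffL_apply, fourierCoeff_mono,
    hΘ.fourierCoeff_mul (sum_mono_mem_hardy 0 _)]
  simp only [Finset.Icc_self, Finset.sum_singleton, sub_self, fourierCoeff_mono, if_true]
  rfl

/-- The evaluation at `0` on the model space has a right inverse with values in the bounded
functions. -/
theorem IsPureInner.exists_section (hΘ : IsPureInner Θ) :
    ∃ σ : E →L[ℂ] modelSpace Θ, ∀ x, (σ x : L2 E) ∈ bounded E ∧ fourierCoeff (σ x : L2 E) 0 = x := by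
  have h1 : ‖fourierCoeff Θ 0 * star (fourierCoeff Θ 0)‖ < 1 := by
    have h2 := hΘ.norm_value_zero_lt_one
    rw [diskValue_zero] at h2
    refine (norm_mul_le _ _).trans_lt ?_
    rw [norm_star]
    exact mul_lt_one_of_nonneg_of_lt_one_left (norm_nonneg _) h2 h2.le
  -- The only use of `‖Θ(0)‖ < 1`: a Neumann series inverts `1 - Θ(0)Θ(0)*`.
  let u := Units.oneSub _ h1
  let k : E →ₗ[ℂ] modelSpace Θ :=
    (hΘ.toIsInner.kernel 0).codRestrict _ fun x => hΘ.toIsInner.kernel_mem_modelSpace le_rfl x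
  refine ⟨(LinearMap.toContinuousLinearMap k).comp (↑u⁻¹ : E →L[ℂ] E), fun x => ⟨?_, ?_⟩⟩
  · exact hΘ.toIsInner.kernel_mem_bounded 0 _
  · refine (hΘ.toIsInner.fourierCoeff_kernel_zero _).trans ?_
    exact congrArg (fun T : E →L[ℂ] E => T x) u.mul_inv

end Model

/-! ### Symbols in `L²(𝓛(E))` and their forms. -/

section Toeplitz

variable {E : Type*} [NormedAddCommGroup E] [InnerProductSpace ℂ E]

section Symbol

theorem memLp_top_mono (n : ℤ) (x : E) : MemLp (mono E n x) ∞ arc := mono_mem_bounded n x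

theorem hasSum_nat_mono [FiniteDimensional ℂ E] {f : L2 E} (hf : f ∈ hardy E) :
    HasSum (fun n : ℕ => mono E n (fourierCoeff f n)) f := by
  have h0 : ∀ n ∉ Set.range ((↑) : ℕ → ℤ), mono E n (fourierCoeff f n) = 0 := fun n hn => by
    have h : n < 0 := by
      by_contra! h
      exact hn ⟨n.toNat, Int.toNat_of_nonneg h⟩
    rw [hf n h, map_zero]
  have hinj : Function.Injective ((↑) : ℕ → ℤ) := Nat.cast_injective
  exact (hinj.hasSum_iff h0).2 (hasSum_mono f)

theorem mulL2_of_eq_shift (Φ : L2 (E →L[ℂ] E)) {n : ℤ} {f f' : L2 E} (h : f' = shift E n f)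
    (hf : MemLp f ∞ arc) (hf' : MemLp f' ∞ arc) :
    mulL2 Φ f' hf' = shift E n (mulL2 Φ f hf) := by
  subst h
  refine Lp.ext ?_
  filter_upwards [coeFn_mulL2 Φ (shift E n f) hf', coeFn_mulL2 Φ f hf,
    coeFn_shift n f, coeFn_shift n (mulL2 Φ f hf)] with t h1 h2 h3 h4
  rw [h1, h3, h4, h2, map_smul]

variable [CompleteSpace E]

/-- For fixed bounded `g` this makes `⟪g, Φf⟫` continuous in `f` for the `L²` norm, although `Φ` may
be unbounded. -/
theorem inner_mulL2_star (Φ : L2 (E →L[ℂ] E)) {f g : L2 E} (hf : MemLp f ∞ arc)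
    (hg : MemLp g ∞ arc) : ⟪g, mulL2 Φ f hf⟫_ℂ = ⟪mulL2 (star Φ) g hg, f⟫_ℂ := by
  rw [L2.inner_def, L2.inner_def]
  refine integral_congr_ae ?_
  filter_upwards [coeFn_mulL2 Φ f hf, coeFn_mulL2 (star Φ) g hg, Lp.coeFn_star Φ] with t h1 h2 h3
  rw [h1, h2, h3, Pi.star_apply, ContinuousLinearMap.star_eq_adjoint,
    ContinuousLinearMap.adjoint_inner_left]

theorem mulL2_mono (Φ : L2 (E →L[ℂ] E)) (n : ℤ) (x : E) :
    mulL2 Φ (mono E n x) (memLp_top_mono n x)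
      = shift E n ((ContinuousLinearMap.apply ℂ E x).compLpL 2 arc Φ) := by
  refine Lp.ext ?_
  filter_upwards [coeFn_mulL2 Φ (mono E n x) (memLp_top_mono n x), coeFn_mono n x,
    (ContinuousLinearMap.apply ℂ E x).coeFn_compLpL (p := 2) (μ := arc) Φ,
    coeFn_shift n ((ContinuousLinearMap.apply ℂ E x).compLpL 2 arc Φ)] with t h1 h2 h3 h4
  rw [h1, h2, h4, h3, map_smul]
  rfl

variable [FiniteDimensional ℂ E]

/-- A linear map from `E` to `L²(E)` is given by a function in `L²(𝓛(E))`. -/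
theorem exists_L2_apply_eq (B : E →ₗ[ℂ] L2 E) :
    ∃ Φ : L2 (E →L[ℂ] E), ∀ x, (ContinuousLinearMap.apply ℂ E x).compLpL 2 arc Φ = B x := by
  let e := stdOrthonormalBasis ℂ E
  -- `r i y` is the rank-one operator `x ↦ ⟪e i, x⟫ y`, so `Φ` is assembled from its columns `B (e
  -- i)`.
  let r : Fin (Module.finrank ℂ E) → E →L[ℂ] E →L[ℂ] E :=
    fun i => ContinuousLinearMap.smulRightL ℂ E E (innerSL ℂ (e i))
  have h : ∀ i x, (ContinuousLinearMap.apply ℂ E x).compLpL 2 arc ((r i).compLpL 2 arc (B (e i)))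
      = ⟪e i, x⟫_ℂ • B (e i) := by
    intro i x
    refine Lp.ext ?_
    filter_upwards [(ContinuousLinearMap.apply ℂ E x).coeFn_compLpL (p := 2) (μ := arc)
      ((r i).compLpL 2 arc (B (e i))), (r i).coeFn_compLpL (p := 2) (μ := arc) (B (e i)),
      Lp.coeFn_smul ⟪e i, x⟫_ℂ (B (e i))] with t h1 h2 h3
    rw [h1, h2, h3]
    rfl
  refine ⟨∑ i, (r i).compLpL 2 arc (B (e i)), fun x => ?_⟩
  rw [map_sum, Finset.sum_congr rfl fun i _ => h i x]
  conv_rhs => rw [← e.sum_repr' x]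
  simp only [map_sum, map_smul]

/-- The form of the multiplication operator with symbol `Φ`, in terms of the columns of `Φ` and
the Fourier coefficients. -/
theorem hasSum_inner_mulL2 (Φ : L2 (E →L[ℂ] E)) {f g : L2 E} (hf : MemLp f ∞ arc)
    (hfh : f ∈ hardy E) (hg : MemLp g ∞ arc) :
    HasSum (fun n : ℕ => ⟪g, shift E n
      ((ContinuousLinearMap.apply ℂ E (fourierCoeff f n)).compLpL 2 arc Φ)⟫_ℂ)
      ⟪g, mulL2 Φ f hf⟫_ℂ := by
  rw [inner_mulL2_star Φ hf hg]
  convert! (innerSL ℂ (mulL2 (star Φ) g hg)).hasSum (hasSum_nat_mono hfh) using 2 with n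
  rw [← mulL2_mono, inner_mulL2_star Φ _ hg]
  rfl

end Symbol

/-! ### The backward shift and its powers. -/

section BackwardShift

variable [FiniteDimensional ℂ E]

/-- The backward shift `f ↦ e^{-it} (f - f(0))`. -/
def backShift (E : Type*) [NormedAddCommGroup E] [InnerProductSpace ℂ E]
    [FiniteDimensional ℂ E] : L2 E →L[ℂ] L2 E :=
  (shift E (-1)).comp (ContinuousLinearMap.id ℂ (L2 E)
    - (LinearMap.toContinuousLinearMap (mono E 0)).comp (coeffL E 0))

theorem backShift_apply (f : L2 E) :
    backShift E f = shift E (-1) (f - mono E 0 (fourierCoeff f 0)) := rfl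

theorem backShift_mem_bounded {f : L2 E} (hf : f ∈ bounded E) : backShift E f ∈ bounded E :=
  shift_mem_bounded _ (sub_mem hf (mono_mem_bounded 0 _))

theorem shift_backShift {f : L2 E} (hf : fourierCoeff f 0 = 0) :
    shift E 1 (backShift E f) = f := by
  rw [backShift_apply, hf, map_zero, sub_zero, shift_shift, add_neg_cancel, shift_zero]

theorem backShift_pow_mem_bounded {f : L2 E} (hf : f ∈ bounded E) (n : ℕ) :
    (backShift E ^ n) f ∈ bounded E := by
  induction n with
  | zero => exact hf
  | succ n ih =>
    rw [pow_succ', mul_apply_eq_comp]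
    exact backShift_mem_bounded ih

variable [CompleteSpace E]

theorem fourierCoeff_backShift (f : L2 E) {n : ℤ} (hn : n ≠ -1) :
    fourierCoeff (backShift E f) n = fourierCoeff f (n + 1) := by
  rw [backShift_apply, fourierCoeff_shift, ← coeffL_apply, map_sub, coeffL_apply, coeffL_apply,
    fourierCoeff_mono, if_neg (by omega), sub_zero, sub_neg_eq_add]

theorem fourierCoeff_backShift_neg_one (f : L2 E) : fourierCoeff (backShift E f) (-1) = 0 := by
  rw [backShift_apply, fourierCoeff_shift, ← coeffL_apply, map_sub, coeffL_apply, coeffL_apply,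
    fourierCoeff_mono]
  simp

theorem backShift_mem_hardy {f : L2 E} (hf : f ∈ hardy E) : backShift E f ∈ hardy E := by
  intro n hn
  by_cases h : n = -1
  · rw [h, fourierCoeff_backShift_neg_one]
  · rw [fourierCoeff_backShift f h, hf _ (by omega)]

/-- The constant removed from `g` does not matter, since `e^{it} f` has zero mean. -/
theorem inner_backShift {f : L2 E} (hf : f ∈ hardy E) (g : L2 E) :
    ⟪f, backShift E g⟫_ℂ = ⟪shift E 1 f, g⟫_ℂ := by
  rw [backShift_apply, ← inner_shift_left, inner_sub_right, inner_mono_right, fourierCoeff_shift,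
    hf _ (by norm_num), inner_zero_left, sub_zero]

theorem inner_backShift_pow {f : L2 E} (hf : f ∈ hardy E) (g : L2 E) (n : ℕ) :
    ⟪f, (backShift E ^ n) g⟫_ℂ = ⟪shift E n f, g⟫_ℂ := by
  induction n generalizing g with
  | zero => simp [shift_zero]
  | succ n ih =>
    rw [pow_succ, mul_apply_eq_comp, ih,
      inner_backShift (shift_mem_hardy (by omega) hf), shift_shift]
    push_cast
    rw [add_comm]

theorem fourierCoeff_backShift_pow (f : L2 E) (n : ℕ) {m : ℤ} (hm : 0 ≤ m) :
    fourierCoeff ((backShift E ^ n) f) m = fourierCoeff f (m + n) := by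
  induction n generalizing f with
  | zero => simp
  | succ n ih =>
    rw [pow_succ, mul_apply_eq_comp, ih, fourierCoeff_backShift f (by omega)]
    push_cast
    ring_nf

theorem backShift_pow_apply (f : L2 E) (n : ℕ) :
    (backShift E ^ n) f
      = shift E (-n) (f - ∑ j ∈ Finset.range n, mono E j (fourierCoeff f j)) := by
  induction n with
  | zero => simp [shift_zero]
  | succ n ih =>
    rw [pow_succ', mul_apply_eq_comp, backShift_apply,
      fourierCoeff_backShift_pow f n le_rfl, ih, map_sub, shift_shift, shift_mono,
      Finset.sum_range_succ, ← sub_sub, map_sub (shift E _) _ (mono E n _), shift_mono]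
    push_cast
    ring_nf

/-- Shifts are isometric, so the norm of the `n`-th power at `f` is that of a tail of the Fourier
series. -/
theorem tendsto_backShift_pow {f : L2 E} (hf : f ∈ hardy E) :
    Filter.Tendsto (fun n : ℕ => (backShift E ^ n) f) Filter.atTop (nhds 0) := by
  rw [tendsto_zero_iff_norm_tendsto_zero]
  simp only [backShift_pow_apply, norm_shift]
  have h := (hasSum_nat_mono hf).tendsto_sum_nat.const_sub f
  rw [sub_self] at h
  simpa using h.norm

variable {Θ : L2 (E →L[ℂ] E)}

/-- By adjointness the pairing with `Θh` becomes that of `f` with `Θ(zh)`, which is zero. -/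
theorem IsInner.backShift_mem_modelSpace (hΘ : IsInner Θ) {f : L2 E} (hf : f ∈ modelSpace Θ) :
    backShift E f ∈ modelSpace Θ := by
  rw [hΘ.mem_modelSpace_iff]
  refine ⟨backShift_mem_hardy hf.1, fun h hh => ?_⟩
  rw [inner_backShift (hΘ.mul_mem_hardy hh), ← hΘ.mul_shift]
  exact (hΘ.mem_modelSpace_iff.1 hf).2 _ (shift_mem_hardy zero_le_one hh)

/-- The backward shift on the model space. -/
def IsInner.modelBackShift (hΘ : IsInner Θ) : modelSpace Θ →L[ℂ] modelSpace Θ :=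
  (backShift E).restrict fun _ hf => hΘ.backShift_mem_modelSpace hf

theorem IsInner.coe_modelBackShift (hΘ : IsInner Θ) (f : modelSpace Θ) :
    (hΘ.modelBackShift f : L2 E) = backShift E f := rfl

theorem IsInner.coe_modelBackShift_pow (hΘ : IsInner Θ) (f : modelSpace Θ) (n : ℕ) :
    ((hΘ.modelBackShift ^ n) f : L2 E) = (backShift E ^ n) f := by
  induction n generalizing f with
  | zero => rfl
  | succ n ih =>
    rw [pow_succ, pow_succ, mul_apply_eq_comp,
      mul_apply_eq_comp, ih, hΘ.coe_modelBackShift]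

theorem IsInner.tendsto_modelBackShift_pow (hΘ : IsInner Θ) (f : modelSpace Θ) :
    Filter.Tendsto (fun n : ℕ => (hΘ.modelBackShift ^ n) f) Filter.atTop (nhds 0) := by
  rw [tendsto_subtype_rng]
  simp only [hΘ.coe_modelBackShift_pow]
  exact tendsto_backShift_pow f.2.1

end BackwardShift

end Toeplitz

/-! ### Shift invariance characterises truncated Toeplitz operators. -/

section ShiftInvariance

variable {E : Type*} [NormedAddCommGroup E] [InnerProductSpace ℂ E] [CompleteSpace E]
  {Θ : L2 (E →L[ℂ] E)}

/-- Shift invariance of an operator on the model space, on bounded functions: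
`⟪z g, A (z f)⟫ = ⟪g, A f⟫` whenever `f`, `g`, `z f`, `z g` are in the model space. -/
def IsShiftInvariant (A : modelSpace Θ →L[ℂ] modelSpace Θ) : Prop :=
  ∀ f g f' g' : modelSpace Θ, (f : L2 E) ∈ bounded E → (g : L2 E) ∈ bounded E →
    (f' : L2 E) = shift E 1 f → (g' : L2 E) = shift E 1 g → ⟪g', A f'⟫_ℂ = ⟪g, A f⟫_ℂ

theorem HasSymbol.inner_apply {A : modelSpace Θ →L[ℂ] modelSpace Θ} {Φ : L2 (E →L[ℂ] E)}
    (h : HasSymbol Θ A Φ) (f g : modelSpace Θ) (hf : MemLp (f : L2 E) ∞ arc) :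
    ⟪g, A f⟫_ℂ = ⟪(g : L2 E), mulL2 Φ f hf⟫_ℂ := by
  rw [h f hf, modelProj, Submodule.inner_orthogonalProjectionOnto_eq_of_mem_left]

theorem HasSymbol.isShiftInvariant {A : modelSpace Θ →L[ℂ] modelSpace Θ} {Φ : L2 (E →L[ℂ] E)}
    (h : HasSymbol Θ A Φ) : IsShiftInvariant A := by
  intro f g f' g' hf hg hff hgg
  have hf' : MemLp (f' : L2 E) ∞ arc := by
    rw [hff]
    exact shift_mem_bounded 1 hf
  rw [h.inner_apply f' g' hf', h.inner_apply f g hf, mulL2_of_eq_shift Φ hff hf hf', hgg,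
    inner_shift_shift]

variable [FiniteDimensional ℂ E]

/-- Bounded test functions `g` suffice by density; boundedness is what lets `Φ` be moved onto `g`.
-/
theorem IsInner.hasSymbol_of_inner (hΘ : IsInner Θ) {A : modelSpace Θ →L[ℂ] modelSpace Θ}
    {Φ : L2 (E →L[ℂ] E)}
    (h : ∀ (f g : modelSpace Θ) (hf : MemLp (f : L2 E) ∞ arc), MemLp (g : L2 E) ∞ arc →
      ⟪g, A f⟫_ℂ = ⟪(g : L2 E), mulL2 Φ f hf⟫_ℂ) : HasSymbol Θ A Φ := by
  intro f hf
  rw [← sub_eq_zero, ← Submodule.coe_eq_zero]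
  refine hΘ.eq_zero_of_inner_bounded (Subtype.property _) fun g hg hgb => ?_
  have h1 := h f ⟨g, hg⟩ hf hgb
  rw [← Submodule.inner_orthogonalProjectionOnto_eq_of_mem_left] at h1
  rw [AddSubgroupClass.coe_sub, inner_sub_right, sub_eq_zero]
  exact h1

/-- For a shift invariant operator `A`, the operator `T = A - L* A L`, with `L` the backward
shift, is of the form `B ev₀ + (C ev₀)*`. -/
theorem IsPureInner.exists_decomposition (hΘ : IsPureInner Θ)
    {A : modelSpace Θ →L[ℂ] modelSpace Θ} (hA : IsShiftInvariant A) :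
    ∃ B C : E →L[ℂ] modelSpace Θ, ∀ f g : modelSpace Θ,
      (f : L2 E) ∈ bounded E → (g : L2 E) ∈ bounded E →
      ⟪g, A f⟫_ℂ - ⟪hΘ.toIsInner.modelBackShift g, A (hΘ.toIsInner.modelBackShift f)⟫_ℂ
        = ⟪g, B (fourierCoeff (f : L2 E) 0)⟫_ℂ + ⟪C (fourierCoeff (g : L2 E) 0), f⟫_ℂ := by
  obtain ⟨σ, hσ⟩ := hΘ.exists_section
  set L := hΘ.toIsInner.modelBackShift with hL
  let ev : modelSpace Θ →L[ℂ] E := (coeffL E 0).comp (modelSpace Θ).subtypeL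
  have hev : ∀ f, ev f = fourierCoeff (f : L2 E) 0 := fun f => rfl
  let R : modelSpace Θ →L[ℂ] modelSpace Θ := ContinuousLinearMap.id ℂ _ - σ.comp ev
  have hR : ∀ f, R f = f - σ (ev f) := fun f => rfl
  have hR0 : ∀ f, ev (R f) = 0 := fun f => by
    rw [hR, map_sub, hev (σ _), (hσ _).2, sub_self]
  have hRb : ∀ f : modelSpace Θ, (f : L2 E) ∈ bounded E → (R f : L2 E) ∈ bounded E := fun f hf => by
    rw [hR, AddSubgroupClass.coe_sub]
    exact sub_mem hf (hσ _).1
  let T : modelSpace Θ →L[ℂ] modelSpace Θ := A - L.adjoint.comp (A.comp L)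
  have hT : ∀ f g, ⟪g, T f⟫_ℂ = ⟪g, A f⟫_ℂ - ⟪L g, A (L f)⟫_ℂ := fun f g => by
    have h : T f = A f - L.adjoint (A (L f)) := rfl
    rw [h, inner_sub_right, ContinuousLinearMap.adjoint_inner_right]
  -- `R f` vanishes at `0`, so `R f = z · L (R f)`; shift invariance is applied to `L (R f)` and `L
  -- (R g)`.
  have hTR : ∀ f g : modelSpace Θ, (f : L2 E) ∈ bounded E → (g : L2 E) ∈ bounded E →
      ⟪R g, T (R f)⟫_ℂ = 0 := by
    intro f g hf hg
    rw [hT, sub_eq_zero]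
    refine hA _ _ _ _ (backShift_mem_bounded (hRb f hf)) (backShift_mem_bounded (hRb g hg)) ?_ ?_
    · exact (shift_backShift (hR0 f)).symm
    · exact (shift_backShift (hR0 g)).symm
  -- Split `f = σ(f(0)) + Rf`, and in the `Rf` term split `g` likewise: `⟪g, Tf⟫ = ⟪g, Tσ f(0)⟫ + ⟪σ
  -- g(0), TRf⟫ + ⟪Rg, TRf⟫`, where the last term is zero.
  refine ⟨T.comp σ, R.adjoint.comp (T.adjoint.comp σ), fun f g hf hg => ?_⟩
  have hf' : f = σ (ev f) + R f := by rw [hR, add_sub_cancel]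
  have hg' : g = σ (ev g) + R g := by rw [hR, add_sub_cancel]
  rw [← hT, ← hev, ← hev]
  simp only [ContinuousLinearMap.comp_apply]
  rw [ContinuousLinearMap.adjoint_inner_left, ContinuousLinearMap.adjoint_inner_left]
  conv_lhs => rw [hf', map_add, inner_add_right]
  congr 1
  conv_lhs => rw [hg', inner_add_left, hTR f g hf hg, add_zero]

theorem IsInner.inner_eq_sum_add (hΘ : IsInner Θ) (A : modelSpace Θ →L[ℂ] modelSpace Θ)
    (f g : modelSpace Θ) (n : ℕ) :
    ⟪g, A f⟫_ℂ = ∑ j ∈ Finset.range n,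
      (⟪(hΘ.modelBackShift ^ j) g, A ((hΘ.modelBackShift ^ j) f)⟫_ℂ
        - ⟪hΘ.modelBackShift ((hΘ.modelBackShift ^ j) g),
          A (hΘ.modelBackShift ((hΘ.modelBackShift ^ j) f))⟫_ℂ)
      + ⟪(hΘ.modelBackShift ^ n) g, A ((hΘ.modelBackShift ^ n) f)⟫_ℂ := by
  simp only [← mul_apply_eq_comp, ← pow_succ']
  rw [Finset.sum_range_sub']
  simp

/-- A shift invariant operator is a truncated Toeplitz operator. -/
theorem IsPureInner.exists_hasSymbol (hΘ : IsPureInner Θ)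
    {A : modelSpace Θ →L[ℂ] modelSpace Θ} (hA : IsShiftInvariant A) :
    ∃ Φ, HasSymbol Θ A Φ := by
  obtain ⟨B, C, hBC⟩ := hΘ.exists_decomposition hA
  obtain ⟨Φ, hΦ⟩ := exists_L2_apply_eq ((modelSpace Θ).subtype ∘ₗ B.toLinearMap)
  obtain ⟨Ψ, hΨ⟩ := exists_L2_apply_eq ((modelSpace Θ).subtype ∘ₗ C.toLinearMap)
  refine ⟨Φ + star Ψ, hΘ.toIsInner.hasSymbol_of_inner fun f g hf hg => ?_⟩
  set L := hΘ.toIsInner.modelBackShift with hL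
  have hLpow : ∀ (f : modelSpace Θ) (j : ℕ), ((L ^ j) f : L2 E) = (backShift E ^ j) f :=
    hΘ.toIsInner.coe_modelBackShift_pow
  have hev : ∀ (f : modelSpace Θ) (j : ℕ), fourierCoeff ((L ^ j) f : L2 E) 0 = fourierCoeff (f : L2 E) j :=
    fun f j => by rw [hLpow, fourierCoeff_backShift_pow _ _ le_rfl, zero_add]
  have hpow : ∀ (u g : modelSpace Θ) (j : ℕ), ⟪(L ^ j) g, u⟫_ℂ = ⟪(g : L2 E), shift E j u⟫_ℂ :=
    fun u g j => by
      rw [← inner_conj_symm (g : L2 E), ← inner_backShift_pow u.2.1, inner_conj_symm, ← hLpow]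
      rfl
  have h1 := hasSum_inner_mulL2 Φ hf f.2.1 hg
  have h2 := (hasSum_inner_mulL2 Ψ hg g.2.1 hf).star
  simp only [hΦ] at h1
  simp only [hΨ] at h2
  have h3 := (h1.add h2).tendsto_sum_nat
  -- The remainder of the telescoping sum.
  have h4 : Filter.Tendsto (fun n : ℕ => ⟪(L ^ n) g, A ((L ^ n) f)⟫_ℂ) Filter.atTop (nhds 0) := by
    have h5 := (hΘ.toIsInner.tendsto_modelBackShift_pow g).inner (𝕜 := ℂ)
      ((A.continuous.tendsto 0).comp (hΘ.toIsInner.tendsto_modelBackShift_pow f))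
    rwa [inner_zero_left] at h5
  have h6 := h3.add h4
  have h7 : ⟪(g : L2 E), mulL2 (Φ + star Ψ) f hf⟫_ℂ
      = ⟪(g : L2 E), mulL2 Φ f hf⟫_ℂ + star ⟪(f : L2 E), mulL2 Ψ g hg⟫_ℂ := by
    rw [mulL2_add, inner_add_right, inner_mulL2_star (star Ψ) hf hg, star_star]
    congr 1
    exact (inner_conj_symm _ _).symm
  rw [h7, ← add_zero (_ + star _)]
  refine tendsto_nhds_unique (tendsto_const_nhds.congr fun n => ?_) h6
  rw [hΘ.toIsInner.inner_eq_sum_add A f g n]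
  congr 1
  refine Finset.sum_congr rfl fun j _ => ?_
  simp only [LinearMap.comp_apply, Submodule.subtype_apply, ContinuousLinearMap.coe_coe]
  rw [hBC _ _ (by rw [hLpow]; exact backShift_pow_mem_bounded hf j)
    (by rw [hLpow]; exact backShift_pow_mem_bounded hg j), hev, hev, hpow]
  congr 1
  rw [← hpow (C (fourierCoeff (g : L2 E) j)) f j]
  exact (inner_conj_symm (𝕜 := ℂ) (C (fourierCoeff (g : L2 E) j)) ((L ^ j) f)).symm

theorem IsPureInner.mem_MTT_iff (hΘ : IsPureInner Θ) (A : modelSpace Θ →L[ℂ] modelSpace Θ) :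
    A ∈ MTT Θ ↔ IsShiftInvariant A :=
  ⟨fun ⟨_, h⟩ => h.isShiftInvariant, hΘ.exists_hasSymbol⟩

end ShiftInvariance

end MatrixTTO

end

theorem mainTheorem6 {E : Type*} [NormedAddCommGroup E] [InnerProductSpace ℂ E]
    [CompleteSpace E] [FiniteDimensional ℂ E]
    (Θ : MatrixTTO.L2 (E →L[ℂ] E)) (hΘ : MatrixTTO.IsPureInner Θ) :
    IsClosed {A : MatrixTTO.modelSpace Θ →WOT[ℂ] MatrixTTO.modelSpace Θ |
      A.toCLM ∈ MatrixTTO.MTT Θ} := by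
  have hc : ∀ u v : MatrixTTO.modelSpace Θ, Continuous
      fun A : MatrixTTO.modelSpace Θ →WOT[ℂ] MatrixTTO.modelSpace Θ => ⟪v, A.toCLM u⟫_ℂ :=
    fun u v => ContinuousLinearMapWOT.continuous_dual_apply u (innerSL ℂ v)
  -- The side conditions on `f`, `g`, `f'`, `g'` do not involve `A`, so the set is an intersection
  -- of sets cut out by a single equation.
  simp only [hΘ.mem_MTT_iff, MatrixTTO.IsShiftInvariant, Set.ofPred_forall]
  refine isClosed_iInter fun f => isClosed_iInter fun g => isClosed_iInter fun f' =>
    isClosed_iInter fun g' => isClosed_iInter fun _ => isClosed_iInter fun _ =>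
    isClosed_iInter fun _ => isClosed_iInter fun _ => ?_
  exact isClosed_eq (hc f' g') (hc f g)
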